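/- Let $O(3)$ and $SO(3)$ be the groups of real orthogonal $3\times 3$ matrices and of those with determinant $1$, with their usual topology, and let $Z_2^{\mathcal T}=\{E,\mathcal T\}$ be the (discrete) group of order two generated by $\mathcal T$. For $g\in O(3)$ put $\eta(g)=\frac{1-\det g}{2}\in\{0,1\}$. Let $R_z(\pi),R_x(\pi)\in SO(3)$ be the rotations by the angle $\pi$ about two perpendicular axes $z$ and $x$ of $\mathbb R^3$. Call two continuous homomorphisms $\tilde\phi,\tilde\psi: O(3)\times Z_2^{\mathcal T}\to SO(3)$ conjugation equivalent if there is $h\in SO(3)$ such that $\tilde\psi(a)=h\,\tilde\phi(a)\,h^{-1}$ for all $a\in O(3)\times Z_2^{\mathcal T}$. Then, up to conjugation equivalence, there are exactly six continuous homomorphisms $O(3)\times Z_2^{\mathcal T}\to SO(3)$. They are represented by the following six maps, which are continuous homomorphisms, are pairwise inequivalent, and are such that every continuous homomorphism $O(3)\times Z_2^{\mathcal T}\to SO(3)$ is equivalent to one of them: for $g\in O(3)$ and $\epsilon\in\{0,1\}$, \begin{align*} \tilde\phi_1(g,\mathcal T^\epsilon)&=E, & \tilde\phi_2(g,\mathcal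 T^\epsilon)&=R_z(\pi)^{\epsilon}, & \tilde\phi_3(g,\mathcal T^\epsilon)&=R_z(\pi)^{\eta(g)},\\ \tilde\phi_4(g,\mathcal T^\epsilon)&=R_z(\pi)^{\eta(g)+\epsilon}, & \tilde\phi_5(g,\mathcal T^\epsilon)&=R_z(\pi)^{\eta(g)}R_x(\pi)^{\epsilon}, & \tilde\phi_6(g,\mathcal T^\epsilon)&=(\det g)\,g, \end{align*} where $E$ is the identity matrix and all exponents are understood modulo $2$. -/

import Mathlib

/-- The orthogonal group `O(3)` of real orthogonal `3 × 3` matrices (with the subspace topology). -/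
abbrev O3 : Type := Matrix.orthogonalGroup (Fin 3) ℝ

/-- The rotation group `SO(3)` (with the subspace topology). -/
abbrev SO3 : Type := Matrix.specialOrthogonalGroup (Fin 3) ℝ

/-- The two-element discrete group generated by time reversal, written multiplicatively:
`Multiplicative.ofAdd ε` is `𝒯 ^ ε`. -/
abbrev Z2T : Type := Multiplicative (ZMod 2)

/-- The matrix of the linear map `v ↦ n × v`. -/
def crossMatrix (n : Fin 3 → ℝ) : Matrix (Fin 3) (Fin 3) ℝ :=
  !![0, -n 2, n 1; n 2, 0, -n 0; -n 1, n 0, 0]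

theorem crossMatrix_mulVec (n v : Fin 3 → ℝ) :
    (crossMatrix n).mulVec v = crossProduct n v := by
  ext i
  fin_cases i <;>
    simp [crossMatrix, crossProduct, Matrix.mulVec, dotProduct, Fin.sum_univ_three] <;> ring

/-- The matrix of the rotation by the angle `θ` about the axis spanned by the unit vector `n`:
`v ↦ cos θ • v + sin θ • (n × v) + (1 - cos θ) • (n ⬝ v) n`. -/
noncomputable def rotationMatrix (n : Fin 3 → ℝ) (θ : ℝ) : Matrix (Fin 3) (Fin 3) ℝ :=
  Real.cos θ • (1 : Matrix (Fin 3) (Fin 3) ℝ) + Real.sin θ • crossMatrix n +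
    (1 - Real.cos θ) • Matrix.vecMulVec n n

theorem rotationMatrix_mem (n : Fin 3 → ℝ) (hn : n ⬝ᵥ n = 1) (θ : ℝ) :
    rotationMatrix n θ ∈ Matrix.specialOrthogonalGroup (Fin 3) ℝ := by
  rw [Matrix.mem_specialOrthogonalGroup_iff, Matrix.mem_orthogonalGroup_iff]
  have h := Real.sin_sq_add_cos_sq θ
  simp only [dotProduct, Fin.sum_univ_three] at hn
  set s := Real.sin θ with hs
  set c := Real.cos θ with hc
  have hA : rotationMatrix n θ =
    !![c + (1 - c) * (n 0 * n 0), -s * n 2 + (1 - c) * (n 0 * n 1), s * n 1 + (1 - c) * (n 0 * n 2);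
      s * n 2 + (1 - c) * (n 1 * n 0), c + (1 - c) * (n 1 * n 1), -s * n 0 + (1 - c) * (n 1 * n 2);
      -s * n 1 + (1 - c) * (n 2 * n 0), s * n 0 + (1 - c) * (n 2 * n 1), c + (1 - c) * (n 2 * n 2)] := by
    ext i j
    fin_cases i <;> fin_cases j <;> simp [rotationMatrix, crossMatrix, Matrix.vecMulVec, hs, hc]
  rw [hA]
  refine ⟨?_, ?_⟩
  · rw [Matrix.one_fin_three]
    ext i j
    fin_cases i <;> fin_cases j <;>
      simp only [Matrix.mul_apply, Matrix.transpose_apply, Fin.sum_univ_three, Fin.zero_eta,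
        Fin.mk_one, Fin.reduceFinMk, Matrix.of_apply, Matrix.cons_val]
    · linear_combination (1 * s ^ 2 + n 0 * n 0 * (1 - c) ^ 2) * hn + (1 - n 0 * n 0) * h
    · linear_combination (0 * s ^ 2 + n 0 * n 1 * (1 - c) ^ 2) * hn + (0 - n 0 * n 1) * h
    · linear_combination (0 * s ^ 2 + n 0 * n 2 * (1 - c) ^ 2) * hn + (0 - n 0 * n 2) * h
    · linear_combination (0 * s ^ 2 + n 1 * n 0 * (1 - c) ^ 2) * hn + (0 - n 1 * n 0) * h
    · linear_combination (1 * s ^ 2 + n 1 * n 1 * (1 - c) ^ 2) * hn + (1 - n 1 * n 1) * h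
    · linear_combination (0 * s ^ 2 + n 1 * n 2 * (1 - c) ^ 2) * hn + (0 - n 1 * n 2) * h
    · linear_combination (0 * s ^ 2 + n 2 * n 0 * (1 - c) ^ 2) * hn + (0 - n 2 * n 0) * h
    · linear_combination (0 * s ^ 2 + n 2 * n 1 * (1 - c) ^ 2) * hn + (0 - n 2 * n 1) * h
    · linear_combination (1 * s ^ 2 + n 2 * n 2 * (1 - c) ^ 2) * hn + (1 - n 2 * n 2) * h
  · rw [Matrix.det_fin_three]
    simp only [Matrix.of_apply, Matrix.cons_val]
    linear_combination (c ^ 2 * (1 - c) + c * s ^ 2 +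
      (1 - c) * s ^ 2 * (n 0 * n 0 + n 1 * n 1 + n 2 * n 2 + 1)) * hn + h

/-- The rotation `R_n(θ)` by the angle `θ` about the unit vector `n`. -/
noncomputable def axisRotation (n : Fin 3 → ℝ) (hn : n ⬝ᵥ n = 1) (θ : ℝ) : SO3 :=
  ⟨rotationMatrix n θ, rotationMatrix_mem n hn θ⟩

theorem O3.det_eq (g : O3) : (g : Matrix (Fin 3) (Fin 3) ℝ).det = 1 ∨
    (g : Matrix (Fin 3) (Fin 3) ℝ).det = -1 := by
  have h := (Matrix.mem_orthogonalGroup_iff (Fin 3) ℝ).1 g.2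
  have h2 := congrArg Matrix.det h
  rw [Matrix.det_mul, Matrix.det_transpose, Matrix.det_one] at h2
  exact mul_self_eq_one_iff.1 h2

/-- The parity exponent `η(g) = (1 - det g) / 2`, as an integer modulo `2`. -/
noncomputable def parityExp (g : O3) : ZMod 2 :=
  if (g : Matrix (Fin 3) (Fin 3) ℝ).det = 1 then 0 else 1

theorem parityExp_val (g : O3) :
    ((parityExp g).val : ℝ) = (1 - (g : Matrix (Fin 3) (Fin 3) ℝ).det) / 2 := by
  rcases O3.det_eq g with h | h
  · simp [parityExp, h]
  · have h1 : (-1 : ℝ) ≠ 1 := by norm_num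
    simp [parityExp, h, h1, ZMod.val_one]

theorem det_smul_mem (g : O3) :
    (g : Matrix (Fin 3) (Fin 3) ℝ).det • (g : Matrix (Fin 3) (Fin 3) ℝ) ∈
      Matrix.specialOrthogonalGroup (Fin 3) ℝ := by
  have h := (Matrix.mem_orthogonalGroup_iff (Fin 3) ℝ).1 g.2
  rw [Matrix.mem_specialOrthogonalGroup_iff, Matrix.mem_orthogonalGroup_iff, Matrix.det_smul]
  rcases O3.det_eq g with h1 | h1 <;> rw [h1] <;> norm_num [h]

/-- The rotation `(det g) g`, for `g` in `O(3)`. -/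
noncomputable def properPart (g : O3) : SO3 :=
  ⟨(g : Matrix (Fin 3) (Fin 3) ℝ).det • (g : Matrix (Fin 3) (Fin 3) ℝ), det_smul_mem g⟩

/-- Conjugation equivalence of continuous homomorphisms `O(3) × Z₂ → SO(3)`: two homomorphisms
are equivalent when they differ by conjugation by a single element of `SO(3)`. -/
def ConjEquiv (φ ψ : O3 × Z2T →ₜ* SO3) : Prop :=
  ∃ h : SO3, ∀ x : O3 × Z2T, ψ x = h * φ x * h⁻¹

/-- Conjugation equivalence as an equivalence relation. -/
def conjSetoid : Setoid (O3 × Z2T →ₜ* SO3) where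
  r := ConjEquiv
  iseqv :=
    { refl := fun φ => ⟨1, fun x => by simp⟩
      symm := by
        rintro φ ψ ⟨h, hh⟩
        exact ⟨h⁻¹, fun x => by rw [hh x]; group⟩
      trans := by
        rintro φ ψ χ ⟨h, hh⟩ ⟨k, hk⟩
        exact ⟨k * h, fun x => by rw [hk x, hh x]; group⟩ }

/-!
The group `O(3) × Z₂` is the product of `SO(3)` with two central groups of order two, generated by
the inversion `-1` and by the time reversal. A homomorphism to `SO(3)` is therefore a homomorphism
on `SO(3)` together with two commuting elements of square `1` that centralize its image.

The main point is that a continuous endomorphism `f` of `SO(3)` is trivial or inner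
(`SO3.hom_trivial_or_inner`). Half-turns are all conjugate and generate `SO(3)`, so a nontrivial `f`
kills none of them, and then it is injective on the rotations about an axis
(`SO3.cos_eq_one_of_hom_rotZ_eq_one`). The trace of a rotation, `1 + 2 cos θ`, determines the trace
of its square; conversely, injectivity and continuity force the image of a rotation by an acute
angle to have an angle that is not obtuse, so the trace of the image of the rotation by `θ / 2` is
determined by that of the image of the rotation by `θ`. Starting from half-turns, `f` preserves the
trace of the rotations by `k π / 2 ^ n`, and by density of all rotations (`SO3.trace_hom`). In
particular `f` preserves the angles between the axes of half-turns. Hence, after a conjugation, it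
fixes the half-turns about the coordinate axes and about the space diagonal `(1, 1, 1)`
(`SO3.exists_diagonal_conj`). The group generated by these spans the space of matrices, so a matrix
`g` can be read off from the traces of its products with elements of that group
(`SO3.entry_eq_traces`), and these traces agree for `g` and `f g` (`SO3.hom_eq_id`).

If the restriction to `SO(3)` is inner, the centralizer of the image is trivial, which gives
`(det g) g`. If it is trivial, the two commuting elements of square `1` are each trivial or a
half-turn, and two distinct commuting half-turns have perpendicular axes; since `SO(3)` acts
transitively on orthonormal pairs, this gives the other five classes
(`exists_conjEquiv_representative`). The kernels separate the six classes
(`representative_injective`).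
-/

section

open Matrix Filter Topology

/-! ### Rotations, half-turns and orthonormal frames -/

namespace SO3

theorem mul_transpose (g : SO3) : g.1 * g.1ᵀ = 1 :=
  (mem_orthogonalGroup_iff (Fin 3) ℝ).1 g.2.1

theorem transpose_mul (g : SO3) : g.1ᵀ * g.1 = 1 :=
  (mem_orthogonalGroup_iff' (Fin 3) ℝ).1 g.2.1

theorem det_eq (g : SO3) : g.1.det = 1 := g.2.2

theorem coe_mul (g h : SO3) : (g * h).1 = g.1 * h.1 := rfl

theorem coe_one : (1 : SO3).1 = 1 := rfl

theorem coe_inv (g : SO3) : (g⁻¹).1 = g.1ᵀ := rfl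

theorem dotProduct_mulVec_mulVec (g : SO3) (u v : Fin 3 → ℝ) :
    (g.1 *ᵥ u) ⬝ᵥ (g.1 *ᵥ v) = u ⬝ᵥ v := by
  rw [dotProduct_mulVec, ← mulVec_transpose, mulVec_mulVec, transpose_mul, one_mulVec]

theorem trace_conj (h g : SO3) : (h * g * h⁻¹).1.trace = g.1.trace := by
  rw [coe_mul, trace_mul_comm, ← coe_mul, inv_mul_cancel_left]

/-- The rotation by the angle `π` about the unit vector `n`. -/
noncomputable def halfTurn (n : Fin 3 → ℝ) (hn : n ⬝ᵥ n = 1) : SO3 :=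
  axisRotation n hn Real.pi

theorem coe_halfTurn (n : Fin 3 → ℝ) (hn : n ⬝ᵥ n = 1) :
    (halfTurn n hn).1 = (2 : ℝ) • vecMulVec n n - 1 := by
  ext i j
  simp [halfTurn, axisRotation, rotationMatrix]
  ring

theorem trace_halfTurn (n : Fin 3 → ℝ) (hn : n ⬝ᵥ n = 1) : (halfTurn n hn).1.trace = -1 := by
  rw [coe_halfTurn]
  simp [trace_sub, trace_smul, trace_vecMulVec, hn]
  norm_num

theorem halfTurn_ne_one (n : Fin 3 → ℝ) (hn : n ⬝ᵥ n = 1) : halfTurn n hn ≠ 1 := by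
  intro h
  have := trace_halfTurn n hn
  rw [h, coe_one] at this
  simp at this
  norm_num at this

theorem trace_halfTurn_mul_halfTurn (n m : Fin 3 → ℝ) (hn : n ⬝ᵥ n = 1) (hm : m ⬝ᵥ m = 1) :
    (halfTurn n hn * halfTurn m hm).1.trace = 4 * (n ⬝ᵥ m) ^ 2 - 1 := by
  rw [coe_mul, coe_halfTurn, coe_halfTurn, sub_mul, mul_sub]
  simp [trace_sub, trace_smul, trace_vecMulVec, hn, hm, vecMulVec_mul_vecMulVec]
  ring

theorem halfTurn_mul_self (n : Fin 3 → ℝ) (hn : n ⬝ᵥ n = 1) :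
    halfTurn n hn * halfTurn n hn = 1 := by
  apply Subtype.ext
  rw [coe_mul, coe_halfTurn, coe_one, sub_mul, mul_sub]
  simp only [smul_mul_smul, vecMulVec_mul_vecMulVec, hn]
  simp only [one_smul, mul_one, one_mul]
  module

theorem conj_halfTurn (g : SO3) (n m : Fin 3 → ℝ) (hn : n ⬝ᵥ n = 1) (hm : m ⬝ᵥ m = 1)
    (h : g.1 *ᵥ n = m) : g * halfTurn n hn * g⁻¹ = halfTurn m hm := by
  subst h
  apply Subtype.ext
  rw [coe_mul, coe_mul, coe_halfTurn, coe_halfTurn, coe_inv, mul_sub, sub_mul, mul_one,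
    mul_transpose, mul_smul_comm, mul_vecMulVec, smul_mul_assoc, vecMulVec_mul, vecMul_transpose]

/-- A pair of orthonormal vectors is the image of the first two coordinate vectors under a
rotation, whose third column is the cross product of the pair. -/
theorem exists_frame (u v : Fin 3 → ℝ) (hu : u ⬝ᵥ u = 1) (hv : v ⬝ᵥ v = 1) (huv : u ⬝ᵥ v = 0) :
    ∃ g : SO3, g.1 *ᵥ ![1, 0, 0] = u ∧ g.1 *ᵥ ![0, 1, 0] = v := by
  have hw : (crossProduct u v) ⬝ᵥ (crossProduct u v) = 1 := by
    rw [cross_dot_cross, hu, hv, huv]; simp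
  have huw := dot_self_cross u v
  have hvw := dot_cross_self u v
  have hT : (Matrix.of ![u, v, crossProduct u v]) * (Matrix.of ![u, v, crossProduct u v])ᵀ = 1 := by
    ext i j
    rw [mul_apply']
    change ![u, v, crossProduct u v] i ⬝ᵥ ![u, v, crossProduct u v] j = _
    have hvu : v ⬝ᵥ u = 0 := by rw [dotProduct_comm, huv]
    have hwu : (crossProduct u v) ⬝ᵥ u = 0 := by rw [dotProduct_comm, huw]
    have hwv : (crossProduct u v) ⬝ᵥ v = 0 := by rw [dotProduct_comm, hvw]
    fin_cases i <;> fin_cases j <;> simp only [Fin.zero_eta, Fin.mk_one, Fin.reduceFinMk,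
      cons_val, one_apply_eq, hu, hv, hw, huv, huw, hvw, hvu, hwu, hwv] <;> simp
  have hd : (Matrix.of ![u, v, crossProduct u v]).det = 1 := by
    change det ![u, v, crossProduct u v] = 1
    rw [← triple_product_eq_det, triple_product_permutation, triple_product_permutation, hw]
  refine ⟨⟨(Matrix.of ![u, v, crossProduct u v])ᵀ, ?_⟩, ?_, ?_⟩
  · rw [mem_specialOrthogonalGroup_iff, mem_orthogonalGroup_iff', transpose_transpose,
      det_transpose]
    exact ⟨hT, hd⟩
  · ext i; simp [mulVec, dotProduct, Fin.sum_univ_three]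
  · ext i; simp [mulVec, dotProduct, Fin.sum_univ_three]

/-- `SO(3)` acts transitively on orthonormal pairs. -/
theorem exists_mulVec_eq_pair (u v u' v' : Fin 3 → ℝ) (hu : u ⬝ᵥ u = 1) (hv : v ⬝ᵥ v = 1)
    (huv : u ⬝ᵥ v = 0) (hu' : u' ⬝ᵥ u' = 1) (hv' : v' ⬝ᵥ v' = 1) (huv' : u' ⬝ᵥ v' = 0) :
    ∃ g : SO3, g.1 *ᵥ u = u' ∧ g.1 *ᵥ v = v' := by
  obtain ⟨g, rfl, rfl⟩ := exists_frame u v hu hv huv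
  obtain ⟨g', rfl, rfl⟩ := exists_frame u' v' hu' hv' huv'
  refine ⟨g' * g⁻¹, ?_, ?_⟩ <;>
    rw [mulVec_mulVec, coe_mul, coe_inv, Matrix.mul_assoc, transpose_mul, Matrix.mul_one]

theorem dotProduct_normalize (w : Fin 3 → ℝ) (hw : w ≠ 0) :
    ((Real.sqrt (w ⬝ᵥ w))⁻¹ • w) ⬝ᵥ ((Real.sqrt (w ⬝ᵥ w))⁻¹ • w) = 1 := by
  have hpos : 0 < w ⬝ᵥ w :=
    lt_of_le_of_ne (by simpa using dotProduct_star_self_nonneg w)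
      fun h => hw (dotProduct_self_eq_zero.1 h.symm)
  rw [smul_dotProduct, dotProduct_smul, smul_smul, smul_eq_mul, ← mul_inv,
    Real.mul_self_sqrt hpos.le, inv_mul_cancel₀ hpos.ne']

theorem exists_unit_orthogonal (u : Fin 3 → ℝ) :
    ∃ v : Fin 3 → ℝ, v ⬝ᵥ v = 1 ∧ u ⬝ᵥ v = 0 := by
  have key : ∀ w : Fin 3 → ℝ, w ≠ 0 → u ⬝ᵥ w = 0 → ∃ v : Fin 3 → ℝ, v ⬝ᵥ v = 1 ∧ u ⬝ᵥ v = 0 := by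
    intro w hw h
    exact ⟨_, dotProduct_normalize w hw, by rw [dotProduct_smul, h, smul_zero]⟩
  by_cases h : u 0 = 0
  · exact key ![1, 0, 0] (fun h => by simpa using congrFun h 0)
      (by simp [dotProduct, Fin.sum_univ_three, h])
  · refine key ![-u 1, u 0, 0] (fun h' => h (by simpa using congrFun h' 1)) ?_
    simp [dotProduct, Fin.sum_univ_three]; ring

theorem exists_mulVec_eq (u v : Fin 3 → ℝ) (hu : u ⬝ᵥ u = 1) (hv : v ⬝ᵥ v = 1) :
    ∃ g : SO3, g.1 *ᵥ u = v := by
  obtain ⟨u', h1, h2⟩ := exists_unit_orthogonal u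
  obtain ⟨v', h3, h4⟩ := exists_unit_orthogonal v
  obtain ⟨g, hg, -⟩ := exists_mulVec_eq_pair u u' v v' hu h1 h2 hv h3 h4
  exact ⟨g, hg⟩

theorem dotProduct_e3 : (![0, 0, 1] : Fin 3 → ℝ) ⬝ᵥ ![0, 0, 1] = 1 := by
  simp [dotProduct, Fin.sum_univ_three]

/-- The rotation by the angle `t` about the third coordinate axis. -/
noncomputable def rotZ (t : ℝ) : SO3 := axisRotation ![0, 0, 1] dotProduct_e3 t

theorem coe_rotZ (t : ℝ) : (rotZ t).1 =
    !![Real.cos t, -Real.sin t, 0; Real.sin t, Real.cos t, 0; 0, 0, 1] := by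
  ext i j
  fin_cases i <;> fin_cases j <;> simp [rotZ, axisRotation, rotationMatrix, crossMatrix, vecMulVec]

theorem trace_rotZ (t : ℝ) : (rotZ t).1.trace = 1 + 2 * Real.cos t := by
  rw [coe_rotZ, trace_fin_three]; simp; ring

theorem rotZ_add (s t : ℝ) : rotZ (s + t) = rotZ s * rotZ t := by
  apply Subtype.ext
  rw [coe_mul, coe_rotZ, coe_rotZ, coe_rotZ, Real.cos_add, Real.sin_add]
  ext i j
  fin_cases i <;> fin_cases j <;> simp [mul_apply, Fin.sum_univ_three] <;> ring

theorem rotZ_zero : rotZ 0 = 1 := by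
  apply Subtype.ext
  rw [coe_rotZ, coe_one, one_fin_three]
  simp

theorem rotZ_natCast_mul (k : ℕ) (t : ℝ) : rotZ (k * t) = rotZ t ^ k := by
  induction k with
  | zero => simp [rotZ_zero]
  | succ k ih => rw [pow_succ, ← ih, ← rotZ_add]; congr 1; push_cast; ring

theorem rotZ_pi : rotZ Real.pi = halfTurn ![0, 0, 1] dotProduct_e3 := rfl

theorem continuous_rotZ : Continuous rotZ := by
  refine Continuous.subtype_mk (continuous_matrix fun i j => ?_) _
  simp only [rotationMatrix, Matrix.add_apply, Matrix.smul_apply, smul_eq_mul]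
  fun_prop

/-- Euler's rotation theorem: a rotation fixes a unit vector. -/
theorem exists_axis (g : SO3) : ∃ v : Fin 3 → ℝ, v ⬝ᵥ v = 1 ∧ g.1 *ᵥ v = v := by
  have hdet : (g.1 - 1).det = 0 := by
    have h1 : g.1 - 1 = -(g.1 * (g.1 - 1)ᵀ) := by
      rw [transpose_sub, transpose_one, mul_sub, mul_transpose, mul_one]; abel
    have h2 := congrArg det h1
    rw [det_neg, det_mul, det_transpose, det_eq, one_mul, Fintype.card_fin] at h2
    linarith
  obtain ⟨w, hw, h⟩ := exists_mulVec_eq_zero_iff.2 hdet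
  rw [sub_mulVec, one_mulVec, sub_eq_zero] at h
  exact ⟨_, dotProduct_normalize w hw, by rw [mulVec_smul, h]⟩

theorem exists_rotZ_of_mulVec_eq (g : SO3) (hg : g.1 *ᵥ ![0, 0, 1] = ![0, 0, 1]) :
    ∃ t, g = rotZ t := by
  have h02 : g.1 0 2 = 0 := by
    simpa [mulVec, dotProduct, Fin.sum_univ_three] using congrFun hg 0
  have h12 : g.1 1 2 = 0 := by
    simpa [mulVec, dotProduct, Fin.sum_univ_three] using congrFun hg 1
  have h22 : g.1 2 2 = 1 := by
    simpa [mulVec, dotProduct, Fin.sum_univ_three] using congrFun hg 2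
  have e (i j) := congrFun (congrFun g.transpose_mul i) j
  have r (i j) := congrFun (congrFun g.mul_transpose i) j
  simp only [mul_apply, Fin.sum_univ_three, transpose_apply] at e r
  have r22 := r 2 2
  rw [h22, one_apply_eq] at r22
  have h20 : g.1 2 0 = 0 := by nlinarith [sq_nonneg (g.1 2 0), sq_nonneg (g.1 2 1)]
  have h21 : g.1 2 1 = 0 := by nlinarith [sq_nonneg (g.1 2 0), sq_nonneg (g.1 2 1)]
  have e00 := e 0 0
  have e01 := e 0 1
  rw [h20, one_apply_eq] at e00
  rw [h20, h21, one_apply_ne (by decide)] at e01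
  have hd := g.det_eq
  rw [det_fin_three, h02, h12, h22, h20, h21] at hd
  have h11 : g.1 1 1 = g.1 0 0 := by
    linear_combination g.1 0 0 * hd - g.1 1 1 * e00 + g.1 1 0 * e01
  have h01 : g.1 0 1 = -g.1 1 0 := by
    linear_combination -g.1 1 0 * hd - g.1 0 1 * e00 + g.1 0 0 * e01
  -- the argument of the first column, read as a complex number of norm one
  obtain ⟨t, ht⟩ : ∃ t : ℝ, g.1 0 0 = Real.cos t ∧ g.1 1 0 = Real.sin t := by
    have hn : ‖(⟨g.1 0 0, g.1 1 0⟩ : ℂ)‖ = 1 := by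
      rw [Complex.norm_def, Complex.normSq_mk, Real.sqrt_eq_one]
      linarith
    have hne : (⟨g.1 0 0, g.1 1 0⟩ : ℂ) ≠ 0 := by
      intro h; rw [h, norm_zero] at hn; exact zero_ne_one hn
    refine ⟨Complex.arg ⟨g.1 0 0, g.1 1 0⟩, ?_, ?_⟩
    · rw [Complex.cos_arg hne, hn, div_one]
    · rw [Complex.sin_arg, hn, div_one]
  refine ⟨t, Subtype.ext ?_⟩
  rw [coe_rotZ]
  ext i j
  fin_cases i <;> fin_cases j <;> simp [h02, h12, h22, h20, h21, h11, h01, ht.1, ht.2]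

/-- Every rotation is conjugate to a rotation about the third coordinate axis. -/
theorem exists_eq_conj_rotZ (g : SO3) : ∃ (h : SO3) (t : ℝ), g = h * rotZ t * h⁻¹ := by
  obtain ⟨v, hv, hgv⟩ := exists_axis g
  obtain ⟨h, hh⟩ := exists_mulVec_eq ![0, 0, 1] v dotProduct_e3 hv
  obtain ⟨t, ht⟩ := exists_rotZ_of_mulVec_eq (h⁻¹ * g * h) (by
    rw [coe_mul, coe_mul, ← mulVec_mulVec, hh, ← mulVec_mulVec, hgv, ← hh, mulVec_mulVec,
      coe_inv, transpose_mul, one_mulVec])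
  exact ⟨h, t, by rw [← ht]; group⟩

/-- The rotation by the angle `t` about the third axis is the product of two half-turns about
axes perpendicular to it that enclose the angle `t / 2`. -/
theorem exists_halfTurn_mul_halfTurn_eq_rotZ (t : ℝ) :
    ∃ (n m : Fin 3 → ℝ) (hn : n ⬝ᵥ n = 1) (hm : m ⬝ᵥ m = 1),
      rotZ t = halfTurn n hn * halfTurn m hm := by
  have hn : (![Real.cos (t / 2), Real.sin (t / 2), 0] : Fin 3 → ℝ) ⬝ᵥ
      ![Real.cos (t / 2), Real.sin (t / 2), 0] = 1 := by
    simp [dotProduct, Fin.sum_univ_three, ← sq]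
  have hm : (![1, 0, 0] : Fin 3 → ℝ) ⬝ᵥ ![1, 0, 0] = 1 := by
    simp [dotProduct, Fin.sum_univ_three]
  refine ⟨_, _, hn, hm, Subtype.ext ?_⟩
  have h1 : Real.cos t = 2 * Real.cos (t / 2) ^ 2 - 1 := by
    rw [← Real.cos_two_mul]; congr 1; ring
  have h2 : Real.sin t = 2 * Real.sin (t / 2) * Real.cos (t / 2) := by
    rw [← Real.sin_two_mul]; congr 1; ring
  have h3 := Real.sin_sq_add_cos_sq (t / 2)
  rw [coe_mul, coe_halfTurn, coe_halfTurn, coe_rotZ, h1, h2]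
  ext i j
  fin_cases i <;> fin_cases j <;> simp [mul_apply, Fin.sum_univ_three, vecMulVec, one_apply] <;>
    first | ring1 | linear_combination 2 * h3

/-- Half-turns generate `SO(3)` and are all conjugate: a homomorphism that kills one of them is
trivial. -/
theorem hom_trivial_of_halfTurn {G : Type*} [Group G] (f : SO3 →* G) (n : Fin 3 → ℝ)
    (hn : n ⬝ᵥ n = 1) (h : f (halfTurn n hn) = 1) (g : SO3) : f g = 1 := by
  have hall : ∀ (m : Fin 3 → ℝ) (hm : m ⬝ᵥ m = 1), f (halfTurn m hm) = 1 := by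
    intro m hm
    obtain ⟨k, hk⟩ := exists_mulVec_eq n m hn hm
    rw [← conj_halfTurn k n m hn hm hk]
    simp [h]
  obtain ⟨k, t, rfl⟩ := exists_eq_conj_rotZ g
  obtain ⟨n', m', hn', hm', ht⟩ := exists_halfTurn_mul_halfTurn_eq_rotZ t
  simp [ht, hall]

theorem eq_one_of_trace_eq (g : SO3) (h : g.1.trace = 3) : g = 1 := by
  obtain ⟨k, t, rfl⟩ := exists_eq_conj_rotZ g
  rw [trace_conj, trace_rotZ] at h
  have hc : Real.cos t = 1 := by linarith
  have hs : Real.sin t = 0 := by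
    have := Real.sin_sq_add_cos_sq t
    rw [hc] at this
    nlinarith
  have : rotZ t = 1 := by
    apply Subtype.ext
    rw [coe_rotZ, hc, hs, coe_one, one_fin_three]; simp
  simp [this]

theorem exists_eq_halfTurn_of_trace_eq (g : SO3) (h : g.1.trace = -1) :
    ∃ (n : Fin 3 → ℝ) (hn : n ⬝ᵥ n = 1), g = halfTurn n hn := by
  obtain ⟨k, t, rfl⟩ := exists_eq_conj_rotZ g
  rw [trace_conj, trace_rotZ] at h
  have hc : Real.cos t = -1 := by linarith
  have hs : Real.sin t = 0 := by
    have := Real.sin_sq_add_cos_sq t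
    rw [hc] at this
    nlinarith
  have : rotZ t = rotZ Real.pi := by
    apply Subtype.ext
    rw [coe_rotZ, coe_rotZ, hc, hs, Real.cos_pi, Real.sin_pi]
  refine ⟨k.1 *ᵥ ![0, 0, 1], by rw [dotProduct_mulVec_mulVec, dotProduct_e3], ?_⟩
  rw [this, rotZ_pi]
  exact conj_halfTurn k _ _ _ _ rfl

theorem trace_mul_self (g : SO3) : (g * g).1.trace = (g.1.trace - 1) ^ 2 - 1 := by
  obtain ⟨k, t, rfl⟩ := exists_eq_conj_rotZ g
  rw [show k * rotZ t * k⁻¹ * (k * rotZ t * k⁻¹) = k * (rotZ t * rotZ t) * k⁻¹ by group,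
    trace_conj, trace_conj, ← rotZ_add, ← two_mul, trace_rotZ, trace_rotZ, Real.cos_two_mul]
  ring

theorem trace_eq_of_mul_self (g : SO3) (h : g * g = 1) (hg : g ≠ 1) : g.1.trace = -1 := by
  have h1 := trace_mul_self g
  rw [h, coe_one, trace_one, Fintype.card_fin] at h1
  have h2 : (g.1.trace - 3) * (g.1.trace + 1) = 0 := by push_cast at h1; linarith
  rcases mul_eq_zero.1 h2 with h3 | h3
  · exact absurd (eq_one_of_trace_eq g (by linarith)) hg
  · linarith

/-- An involution of `SO(3)` is a half-turn. -/
theorem exists_eq_halfTurn (g : SO3) (h : g * g = 1) (hg : g ≠ 1) :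
    ∃ (n : Fin 3 → ℝ) (hn : n ⬝ᵥ n = 1), g = halfTurn n hn :=
  exists_eq_halfTurn_of_trace_eq g (trace_eq_of_mul_self g h hg)

/-- Two distinct commuting half-turns have perpendicular axes: their product is an involution, so
its trace `4 (n ⬝ m) ^ 2 - 1` equals `-1`. -/
theorem dotProduct_eq_zero_of_commute (n m : Fin 3 → ℝ) (hn : n ⬝ᵥ n = 1) (hm : m ⬝ᵥ m = 1)
    (hc : halfTurn n hn * halfTurn m hm = halfTurn m hm * halfTurn n hn)
    (hne : halfTurn n hn ≠ halfTurn m hm) : n ⬝ᵥ m = 0 := by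
  have h := trace_eq_of_mul_self (halfTurn n hn * halfTurn m hm)
    (by rw [mul_assoc, hc, ← mul_assoc (halfTurn m hm), halfTurn_mul_self, one_mul,
      halfTurn_mul_self])
    (fun h => hne (by rw [← mul_inv_eq_one, ← h,
      inv_eq_of_mul_eq_one_left (halfTurn_mul_self m hm)]))
  rw [trace_halfTurn_mul_halfTurn] at h
  have : (n ⬝ᵥ m) ^ 2 = 0 := by linarith
  exact pow_eq_zero_iff (two_ne_zero) |>.1 this

theorem trace_pow_eq_of_trace_eq (g g' : SO3) (h : g.1.trace = g'.1.trace) (k : ℕ) :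
    (g ^ k).1.trace = (g' ^ k).1.trace := by
  obtain ⟨a, t, rfl⟩ := exists_eq_conj_rotZ g
  obtain ⟨b, s, rfl⟩ := exists_eq_conj_rotZ g'
  rw [conj_pow, conj_pow]
  simp only [trace_conj, ← rotZ_natCast_mul, trace_rotZ] at h ⊢
  have hc : Real.cos t = Real.cos s := by linarith
  have := congrArg (fun x => (Polynomial.Chebyshev.T ℝ k).eval x) hc
  simp only [Polynomial.Chebyshev.T_real_cos] at this
  push_cast at this
  rw [this]

end SO3

/-! ### Continuous endomorphisms of `SO(3)` -/

namespace SO3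

/-- A nontrivial homomorphism kills no rotation `g` by an angle with nonpositive cosine: such a `g`
moves some unit vector `n` to a vector perpendicular to it, and then the kernel contains the
commutator of `g` with the half-turn about `n`, which is itself a half-turn. -/
theorem cos_pos_of_hom_rotZ_eq_one {G : Type*} [Group G] (f : SO3 →* G) (hf : ∃ g, f g ≠ 1)
    (s : ℝ) (h : f (rotZ s) = 1) : 0 < Real.cos s := by
  by_contra! hc
  obtain ⟨g, hg⟩ := hf
  have hpos : 0 < 1 - Real.cos s := by linarith
  -- the unit vector `(a, 0, b)` is chosen so that its inner product with its image, which is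
  -- `a ^ 2 * cos s + b ^ 2`, vanishes
  obtain ⟨a, ha⟩ : ∃ a : ℝ, a ^ 2 = 1 / (1 - Real.cos s) :=
    ⟨_, Real.sq_sqrt (by positivity)⟩
  obtain ⟨b, hb⟩ : ∃ b : ℝ, b ^ 2 = -Real.cos s / (1 - Real.cos s) :=
    ⟨_, Real.sq_sqrt (div_nonneg (by linarith) hpos.le)⟩
  have hn : (![a, 0, b] : Fin 3 → ℝ) ⬝ᵥ ![a, 0, b] = 1 := by
    simp only [dotProduct, Fin.sum_univ_three, cons_val, ← sq, ha, hb]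
    field_simp
    ring
  have hperp : ((rotZ s).1 *ᵥ ![a, 0, b]) ⬝ᵥ ![a, 0, b] = 0 := by
    have : ((rotZ s).1 *ᵥ ![a, 0, b]) ⬝ᵥ ![a, 0, b] = a ^ 2 * Real.cos s + b ^ 2 := by
      rw [coe_rotZ]
      simp [dotProduct, Fin.sum_univ_three]
      ring
    rw [this, ha, hb]
    field_simp
    ring
  have hm : ((rotZ s).1 *ᵥ ![a, 0, b]) ⬝ᵥ ((rotZ s).1 *ᵥ ![a, 0, b]) = 1 := by
    rw [dotProduct_mulVec_mulVec, hn]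
  have hk : f (halfTurn _ hm * halfTurn _ hn) = 1 := by
    rw [← conj_halfTurn (rotZ s) _ _ hn hm rfl]
    simp only [map_mul, map_inv, h, inv_one, one_mul, mul_one]
    rw [← map_mul, halfTurn_mul_self, map_one]
  obtain ⟨p, hp, e⟩ := exists_eq_halfTurn_of_trace_eq (halfTurn _ hm * halfTurn _ hn) (by
    rw [trace_halfTurn_mul_halfTurn, hperp]; norm_num)
  rw [e] at hk
  exact hg (hom_trivial_of_halfTurn f p hp hk g)

/-- A nontrivial homomorphism is injective on the rotations about a fixed axis: doubling the angle
of a nontrivial rotation in the kernel would eventually make its cosine nonpositive. -/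
theorem cos_eq_one_of_hom_rotZ_eq_one {G : Type*} [Group G] (f : SO3 →* G) (hf : ∃ g, f g ≠ 1)
    (s : ℝ) (h : f (rotZ s) = 1) : Real.cos s = 1 := by
  have hpos : ∀ k : ℕ, 0 < Real.cos (2 ^ k * s) := fun k => by
    apply cos_pos_of_hom_rotZ_eq_one f hf
    have := rotZ_natCast_mul (2 ^ k) s
    push_cast at this
    rw [this, map_pow, h, one_pow]
  have hgrow : ∀ k : ℕ, 2 ^ k * (1 - Real.cos s) ≤ 1 - Real.cos (2 ^ k * s) := by
    intro k
    induction k with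
    | zero => simp
    | succ k ih =>
      have e : (2 : ℝ) ^ (k + 1) * s = 2 * (2 ^ k * s) := by ring
      rw [e, Real.cos_two_mul, pow_succ]
      nlinarith [hpos k, Real.cos_le_one (2 ^ k * s)]
  by_contra hne
  have hlt : 0 < 1 - Real.cos s := by
    have := lt_of_le_of_ne (Real.cos_le_one s) hne
    linarith
  obtain ⟨k, hk⟩ := pow_unbounded_of_one_lt (1 / (1 - Real.cos s)) (one_lt_two (α := ℝ))
  rw [div_lt_iff₀ hlt] at hk
  linarith [hgrow k, hpos k]

theorem trace_hom_halfTurn (f : SO3 →* SO3) (hf : ∃ g, f g ≠ 1) (n : Fin 3 → ℝ)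
    (hn : n ⬝ᵥ n = 1) : (f (halfTurn n hn)).1.trace = -1 := by
  apply trace_eq_of_mul_self
  · rw [← map_mul, halfTurn_mul_self, map_one]
  · intro h
    obtain ⟨g, hg⟩ := hf
    exact hg (hom_trivial_of_halfTurn f n hn h g)

theorem trace_hom_rotZ_two_mul (f : SO3 →* SO3) (t : ℝ) :
    (f (rotZ (2 * t))).1.trace = ((f (rotZ t)).1.trace - 1) ^ 2 - 1 := by
  rw [two_mul, rotZ_add, map_mul, trace_mul_self]

/-- The image of a rotation by at most a right angle is again such a rotation. Otherwise, by the
intermediate value theorem, some rotation by an angle strictly between `0` and `π / 2` would have an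
image of order four, and four times that angle would give a nontrivial rotation in the kernel. -/
theorem one_le_trace_hom_rotZ (f : SO3 →* SO3) (hf : ∃ g, f g ≠ 1)
    (hcont : Continuous f) (t : ℝ) (h0 : 0 ≤ t) (ht : t ≤ Real.pi / 2) :
    1 ≤ (f (rotZ t)).1.trace := by
  by_contra! hlt
  have hc : ContinuousOn (fun t => (f (rotZ t)).1.trace) (Set.Icc 0 t) :=
    ((continuous_subtype_val.comp (hcont.comp continuous_rotZ)).matrix_trace).continuousOn
  have hz : (f (rotZ 0)).1.trace = 3 := by
    rw [rotZ_zero, map_one, coe_one, trace_one]; simp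
  obtain ⟨s, ⟨hs0, hst⟩, hs⟩ := intermediate_value_Icc' h0 hc
    (show (1 : ℝ) ∈ Set.Icc _ _ from ⟨hlt.le, by simp only [hz]; norm_num⟩)
  simp only at hs
  have hspos : 0 < s := lt_of_le_of_ne hs0 (by rintro rfl; rw [hz] at hs; norm_num at hs)
  have hslt : s < t := lt_of_le_of_ne hst (by rintro rfl; exact hlt.ne hs)
  have h2 := trace_hom_rotZ_two_mul f s
  have h4 := trace_hom_rotZ_two_mul f (2 * s)
  rw [h2, hs] at h4
  have hone := cos_eq_one_of_hom_rotZ_eq_one f hf (2 * (2 * s))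
    (eq_one_of_trace_eq _ (by rw [h4]; norm_num))
  rw [Real.cos_eq_one_iff_of_lt_of_lt (by linarith) (by linarith)] at hone
  linarith

theorem trace_hom_rotZ_pi_div (f : SO3 →* SO3) (hf : ∃ g, f g ≠ 1) (hcont : Continuous f) (n : ℕ) :
    (f (rotZ (Real.pi / 2 ^ n))).1.trace = 1 + 2 * Real.cos (Real.pi / 2 ^ n) := by
  have hpi := Real.pi_pos
  induction n with
  | zero =>
    rw [pow_zero, div_one, rotZ_pi, trace_hom_halfTurn f hf, Real.cos_pi]; norm_num
  | succ n ih =>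
    set t := Real.pi / 2 ^ (n + 1) with ht
    have h2t : Real.pi / 2 ^ n = 2 * t := by rw [ht, pow_succ]; field_simp
    have ht0 : 0 ≤ t := by positivity
    have ht1 : t ≤ Real.pi / 2 :=
      div_le_div_of_nonneg_left hpi.le two_pos
        (by rw [pow_succ]; linarith [one_le_pow₀ (one_le_two (α := ℝ)) (n := n)])
    rw [h2t, trace_hom_rotZ_two_mul, Real.cos_two_mul] at ih
    have h1 := one_le_trace_hom_rotZ f hf hcont t ht0 ht1
    have h3 := Real.cos_nonneg_of_neg_pi_div_two_le_of_le (by linarith) ht1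
    have h4 : (f (rotZ t)).1.trace - 1 = 2 * Real.cos t :=
      (sq_eq_sq₀ (by linarith) (by linarith)).1 (by linarith)
    linarith

/-- A nontrivial continuous endomorphism of `SO(3)` preserves the angle of rotations about the third
axis. For the angles `π / 2 ^ n` this follows by halving, hence it holds for their multiples, which
are dense. -/
theorem trace_hom_rotZ (f : SO3 →* SO3) (hf : ∃ g, f g ≠ 1) (hcont : Continuous f) (t : ℝ) :
    (f (rotZ t)).1.trace = 1 + 2 * Real.cos t := by
  have hnonneg : ∀ t : ℝ, 0 ≤ t → (f (rotZ t)).1.trace = 1 + 2 * Real.cos t := by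
    intro t ht
    have hpi := Real.pi_pos
    have hdyad : ∀ k n : ℕ, (f (rotZ (k * (Real.pi / 2 ^ n)))).1.trace =
        1 + 2 * Real.cos (k * (Real.pi / 2 ^ n)) := by
      intro k n
      rw [rotZ_natCast_mul, map_pow, trace_pow_eq_of_trace_eq _ (rotZ (Real.pi / 2 ^ n))
        (by rw [trace_hom_rotZ_pi_div f hf hcont, trace_rotZ]), ← rotZ_natCast_mul, trace_rotZ]
    have hlim : Tendsto (fun n : ℕ => (⌊t / Real.pi * 2 ^ n⌋₊ : ℝ) * (Real.pi / 2 ^ n)) atTop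
        (𝓝 t) := by
      have h1 := ((tendsto_nat_floor_mul_div_atTop (div_nonneg ht hpi.le)).comp
        (tendsto_pow_atTop_atTop_of_one_lt (one_lt_two (α := ℝ)))).mul_const Real.pi
      rw [div_mul_cancel₀ _ hpi.ne'] at h1
      refine h1.congr fun n => ?_
      simp only [Function.comp]
      ring
    have hc : Continuous fun t => (f (rotZ t)).1.trace :=
      (continuous_subtype_val.comp (hcont.comp continuous_rotZ)).matrix_trace
    have hc' : Continuous fun t : ℝ => 1 + 2 * Real.cos t := by fun_prop
    refine tendsto_nhds_unique ((hc.tendsto t).comp hlim) (((hc'.tendsto t).comp hlim).congr ?_)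
    intro n
    exact (hdyad _ n).symm
  rcases le_total 0 t with h | h
  · exact hnonneg t h
  · have hinv : rotZ t = (rotZ (-t))⁻¹ := by
      rw [eq_inv_iff_mul_eq_one, ← rotZ_add, add_neg_cancel, rotZ_zero]
    rw [hinv, map_inv, coe_inv, trace_transpose, hnonneg (-t) (by linarith), Real.cos_neg]

theorem trace_hom (f : SO3 →* SO3) (hf : ∃ g, f g ≠ 1) (hcont : Continuous f) (g : SO3) :
    (f g).1.trace = g.1.trace := by
  obtain ⟨k, t, rfl⟩ := exists_eq_conj_rotZ g
  rw [map_mul, map_mul, map_inv, trace_conj, trace_conj, trace_hom_rotZ f hf hcont, trace_rotZ]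

theorem dotProduct_single (i : Fin 3) :
    (Pi.single i 1 : Fin 3 → ℝ) ⬝ᵥ Pi.single i 1 = 1 := by
  simp

/-- The half-turn about the `i`-th coordinate axis. -/
noncomputable def axisTurn (i : Fin 3) : SO3 := halfTurn (Pi.single i 1) (dotProduct_single i)

theorem dotProduct_diag :
    (fun _ => (Real.sqrt 3)⁻¹ : Fin 3 → ℝ) ⬝ᵥ (fun _ => (Real.sqrt 3)⁻¹) = 1 := by
  have : (Real.sqrt 3)⁻¹ * (Real.sqrt 3)⁻¹ = 1 / 3 := by
    rw [← mul_inv, Real.mul_self_sqrt (by norm_num)]; norm_num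
  simp only [dotProduct, this, Fin.sum_univ_three]
  norm_num

/-- The half-turn about the space diagonal `(1, 1, 1)`. -/
noncomputable def diagTurn : SO3 := halfTurn (fun _ => (Real.sqrt 3)⁻¹) dotProduct_diag

theorem coe_axisTurn (i : Fin 3) :
    (axisTurn i).1 = diagonal (fun j => if j = i then 1 else -1) := by
  rw [axisTurn, coe_halfTurn]
  ext j k
  by_cases h1 : j = k <;> by_cases h2 : j = i <;> by_cases h3 : k = i <;>
    simp_all [vecMulVec, diagonal, one_apply, Pi.single_apply]; norm_num

theorem diagTurn_apply (i j : Fin 3) : diagTurn.1 i j = if i = j then -1 / 3 else 2 / 3 := by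
  have : (Real.sqrt 3)⁻¹ * (Real.sqrt 3)⁻¹ = 1 / 3 := by
    rw [← mul_inv, Real.mul_self_sqrt (by norm_num)]; norm_num
  rw [diagTurn, coe_halfTurn]
  simp only [Matrix.sub_apply, Matrix.smul_apply, vecMulVec_apply, this, one_apply]
  split_ifs <;> norm_num

/-- The half-turns about the coordinate axes and about the space diagonal generate a group that
spans the space of matrices: `(1 + Dᵢ) A (1 + Dⱼ)` is a nonzero multiple of the elementary matrix
at `(i, j)`. This expresses a matrix entry as a combination of traces. -/
theorem entry_eq_traces (M : Matrix (Fin 3) (Fin 3) ℝ) (i j : Fin 3) :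
    4 * (diagTurn.1 i j * M j i) = (M * diagTurn.1).trace
      + (M * ((axisTurn i).1 * diagTurn.1)).trace
      + (M * (diagTurn.1 * (axisTurn j).1)).trace
      + (M * ((axisTurn i).1 * diagTurn.1 * (axisTurn j).1)).trace := by
  have h : diagTurn.1 + (axisTurn i).1 * diagTurn.1 + diagTurn.1 * (axisTurn j).1
      + (axisTurn i).1 * diagTurn.1 * (axisTurn j).1 = single i j (4 * diagTurn.1 i j) := by
    ext k l
    rw [coe_axisTurn, coe_axisTurn]
    simp only [Matrix.add_apply, diagonal_mul, mul_diagonal, single_apply]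
    by_cases hk : i = k <;> by_cases hl : j = l <;> simp [hk, hl, eq_comm (a := k) (b := i),
      eq_comm (a := l) (b := j)]
    subst hk hl
    ring
  rw [← trace_add, ← trace_add, ← trace_add, ← mul_add, ← mul_add, ← mul_add, h]
  rw [trace_mul_single]
  simp
  ring

/-- A trace-preserving endomorphism that fixes the half-turns about the coordinate axes and the
space diagonal is the identity. -/
theorem hom_eq_id (f : SO3 →* SO3) (htr : ∀ g, (f g).1.trace = g.1.trace)
    (hD : ∀ i, f (axisTurn i) = axisTurn i) (hA : f diagTurn = diagTurn) (g : SO3) : f g = g := by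
  apply Subtype.ext
  ext j i
  have key : ∀ s, f s = s → ((f g).1 * s.1).trace = (g.1 * s.1).trace := by
    intro s hs
    rw [← coe_mul, ← coe_mul, ← htr (g * s), map_mul, hs]
  have h1 := entry_eq_traces (f g).1 i j
  have h2 := entry_eq_traces g.1 i j
  simp only [← coe_mul] at h1 h2
  simp only [coe_mul g, coe_mul (f g)] at h1 h2
  rw [key _ hA, key _ (by rw [map_mul, hD, hA]), key _ (by rw [map_mul, hD, hA]),
    key _ (by rw [map_mul, map_mul, hD, hD, hA]), ← h2] at h1
  have hne : diagTurn.1 i j ≠ 0 := by rw [diagTurn_apply]; split_ifs <;> norm_num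
  exact mul_left_cancel₀ hne (mul_left_cancel₀ (by norm_num) h1)

/-- The diagonal rotations act transitively on the four space diagonals of a cube, and they commute
with the half-turns about the coordinate axes. -/
theorem exists_diagonal_conj (w : Fin 3 → ℝ) (hw : w ⬝ᵥ w = 1) (hw3 : ∀ i, w i ^ 2 = 1 / 3) :
    ∃ d : SO3, (∀ i, d * axisTurn i * d⁻¹ = axisTurn i) ∧ d * diagTurn * d⁻¹ = halfTurn w hw := by
  have h3 : Real.sqrt 3 ^ 2 = 3 := Real.sq_sqrt (by norm_num)
  -- the axis of a half-turn is determined up to sign, which allows the choice of the orientation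
  have main : ∀ (w : Fin 3 → ℝ) (hw : w ⬝ᵥ w = 1), (∀ i, w i ^ 2 = 1 / 3) →
      Real.sqrt 3 * w 0 * (Real.sqrt 3 * w 1) * (Real.sqrt 3 * w 2) = 1 →
      ∃ d : SO3, (∀ i, d * axisTurn i * d⁻¹ = axisTurn i) ∧
        d * diagTurn * d⁻¹ = halfTurn w hw := by
    intro w hw hw3 hdet
    have hmem : diagonal (fun i => Real.sqrt 3 * w i) ∈ specialOrthogonalGroup (Fin 3) ℝ := by
      rw [mem_specialOrthogonalGroup_iff, mem_orthogonalGroup_iff, det_diagonal,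
        Fin.prod_univ_three, diagonal_transpose, diagonal_mul_diagonal, diagonal_eq_one]
      refine ⟨?_, hdet⟩
      ext i
      rw [Pi.one_apply]
      linear_combination w i ^ 2 * h3 + 3 * hw3 i
    refine ⟨⟨_, hmem⟩, fun i => ?_, ?_⟩
    · rw [mul_inv_eq_iff_eq_mul]
      apply Subtype.ext
      rw [coe_mul, coe_mul, coe_axisTurn, diagonal_mul_diagonal, diagonal_mul_diagonal]
      simp only [mul_comm]
    · apply conj_halfTurn
      ext i
      rw [mulVec_diagonal]
      have : Real.sqrt 3 ≠ 0 := by positivity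
      field_simp
  have hsq : (Real.sqrt 3 * w 0 * (Real.sqrt 3 * w 1) * (Real.sqrt 3 * w 2)) ^ 2 = 1 := by
    simp only [mul_pow, h3, hw3]; norm_num
  rcases mul_self_eq_one_iff.1 ((sq _).symm.trans hsq) with h | h
  · exact main w hw hw3 h
  · have hneg : -w ⬝ᵥ -w = 1 := by rw [neg_dotProduct_neg, hw]
    have e : halfTurn w hw = halfTurn (-w) hneg := by
      apply Subtype.ext
      rw [coe_halfTurn, coe_halfTurn, neg_vecMulVec, vecMulVec_neg, neg_neg]
    rw [e]
    refine main (-w) hneg (fun i => by simpa using hw3 i) ?_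
    simp only [Pi.neg_apply]
    linear_combination -h

/-- A continuous endomorphism of `SO(3)` is trivial or inner. -/
theorem hom_trivial_or_inner (f : SO3 →* SO3) (hcont : Continuous f) :
    (∀ g, f g = 1) ∨ ∃ h : SO3, ∀ g, f g = h * g * h⁻¹ := by
  by_cases hf : ∀ g, f g = 1
  · exact Or.inl hf
  right
  push Not at hf
  -- after conjugation by `k`, and then by `d`, the map fixes the half-turns about the coordinate
  -- axes and the space diagonal
  have htr := trace_hom f hf hcont
  have himg : ∀ (n : Fin 3 → ℝ) (hn : n ⬝ᵥ n = 1),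
      ∃ (m : Fin 3 → ℝ) (hm : m ⬝ᵥ m = 1), f (halfTurn n hn) = halfTurn m hm := fun n hn =>
    exists_eq_halfTurn_of_trace_eq _ (trace_hom_halfTurn f hf n hn)
  obtain ⟨u, hu, hfu⟩ := himg _ (dotProduct_single 0)
  obtain ⟨v, hv, hfv⟩ := himg _ (dotProduct_single 1)
  have huv : u ⬝ᵥ v = 0 := by
    have h1 := htr (halfTurn _ (dotProduct_single 0) * halfTurn _ (dotProduct_single 1))
    rw [map_mul, hfu, hfv, trace_halfTurn_mul_halfTurn, trace_halfTurn_mul_halfTurn] at h1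
    simpa using h1
  obtain ⟨k, hku, hkv⟩ := exists_mulVec_eq_pair _ _ u v (dotProduct_single 0) (dotProduct_single 1)
    (by simp) hu hv huv
  have hk0 : f (axisTurn 0) = k * axisTurn 0 * k⁻¹ := by
    rw [axisTurn, hfu, conj_halfTurn k _ _ _ hu hku]
  have hk1 : f (axisTurn 1) = k * axisTurn 1 * k⁻¹ := by
    rw [axisTurn, hfv, conj_halfTurn k _ _ _ hv hkv]
  have h2 : axisTurn 2 = axisTurn 0 * axisTurn 1 := by
    apply Subtype.ext
    rw [coe_mul, coe_axisTurn, coe_axisTurn, coe_axisTurn, diagonal_mul_diagonal]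
    congr 1
    ext i
    fin_cases i <;> simp
  have hk : ∀ i, f (axisTurn i) = k * axisTurn i * k⁻¹ := by
    intro i
    fin_cases i
    · exact hk0
    · exact hk1
    · change f (axisTurn 2) = k * axisTurn 2 * k⁻¹
      rw [h2, map_mul, hk0, hk1]; group
  obtain ⟨w', hw', hfw⟩ := himg _ dotProduct_diag
  have hkw : (k⁻¹.1 *ᵥ w') ⬝ᵥ (k⁻¹.1 *ᵥ w') = 1 := by rw [dotProduct_mulVec_mulVec, hw']
  have hkA : k⁻¹ * f diagTurn * k = halfTurn _ hkw := by
    rw [diagTurn, hfw, ← conj_halfTurn k⁻¹ _ _ hw' hkw rfl, inv_inv]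
  -- the angles of the axis of `f diagTurn` with the axes of the `f (axisTurn i)` are preserved
  have hw3 : ∀ i, (k⁻¹.1 *ᵥ w') i ^ 2 = 1 / 3 := by
    intro i
    have h1 : (halfTurn _ hkw * axisTurn i).1.trace = (diagTurn * axisTurn i).1.trace := by
      rw [← htr (diagTurn * axisTurn i), map_mul, hk, ← hkA,
        show f diagTurn * (k * axisTurn i * k⁻¹) =
          k * (k⁻¹ * f diagTurn * k * axisTurn i) * k⁻¹ by group, trace_conj]
    rw [axisTurn, diagTurn, trace_halfTurn_mul_halfTurn, trace_halfTurn_mul_halfTurn] at h1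
    simp only [dotProduct_single_one, inv_pow, Real.sq_sqrt (show (0 : ℝ) ≤ 3 by norm_num)] at h1
    linarith
  obtain ⟨d, hd, hdA⟩ := exists_diagonal_conj _ hkw hw3
  refine ⟨k * d, fun g => ?_⟩
  have hid := hom_eq_id ((MulAut.conj (k * d)⁻¹).toMonoidHom.comp f)
    (fun g => by
      simp only [MonoidHom.comp_apply, MulEquiv.toMonoidHom_eq_coe, MonoidHom.coe_coe,
        MulAut.conj_apply]
      rw [trace_conj, htr])
    (fun i => by
      simp only [MonoidHom.comp_apply, MulEquiv.toMonoidHom_eq_coe, MonoidHom.coe_coe,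
        MulAut.conj_apply]
      rw [hk]
      nth_rewrite 1 [← hd i]
      group)
    (by
      simp only [MonoidHom.comp_apply, MulEquiv.toMonoidHom_eq_coe, MonoidHom.coe_coe,
        MulAut.conj_apply]
      rw [show (k * d)⁻¹ * f diagTurn * (k * d)⁻¹⁻¹ = d⁻¹ * (k⁻¹ * f diagTurn * k) * d by group,
        hkA, ← hdA]
      group) g
  simp only [MonoidHom.comp_apply, MulEquiv.toMonoidHom_eq_coe, MonoidHom.coe_coe,
    MulAut.conj_apply] at hid
  nth_rewrite 2 [← hid]
  group

/-- The center of `SO(3)` is trivial: a central element fixes a unit vector, hence its whole orbit,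
which is the unit sphere. -/
theorem eq_one_of_forall_commute (c : SO3) (h : ∀ g, c * g = g * c) : c = 1 := by
  obtain ⟨v, hv, hcv⟩ := exists_axis c
  have hfix : ∀ i, c.1 *ᵥ Pi.single i 1 = Pi.single i 1 := by
    intro i
    obtain ⟨g, hg⟩ := exists_mulVec_eq v _ hv (dotProduct_single i)
    rw [← hg, mulVec_mulVec, ← coe_mul, h, coe_mul, ← mulVec_mulVec, hcv]
  apply Subtype.ext
  ext i j
  have := congrFun (hfix j) i
  rw [mulVec_single_one] at this
  simpa [one_apply, Pi.single_apply] using this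

end SO3

/-! ### Homomorphisms from `O(3) × Z₂` to `SO(3)` -/

/-- Powers of an element with square `1` make sense for exponents modulo `2`. -/
theorem pow_val_add {G : Type*} [Monoid G] {a : G} (ha : a * a = 1) (s t : ZMod 2) :
    a ^ (s + t).val = a ^ s.val * a ^ t.val := by
  have h : ∀ s : ZMod 2, s = 0 ∨ s = 1 := by decide
  have h2 : (1 + 1 : ZMod 2) = 0 := rfl
  rcases h s with rfl | rfl <;> rcases h t with rfl | rfl <;> simp [ZMod.val_one, h2, ha]

theorem parityExp_mul (g h : O3) : parityExp (g * h) = parityExp g + parityExp h := by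
  have hne : (-1 : ℝ) ≠ 1 := by norm_num
  rcases O3.det_eq g with hg | hg <;> rcases O3.det_eq h with hh | hh <;>
    simp [parityExp, hg, hh, hne]
  rfl

theorem continuous_parityExp : Continuous parityExp := by
  have hdet : Continuous fun g : O3 => g.1.det := continuous_subtype_val.matrix_det
  have hset : {g : O3 | g.1.det = 1} = {g : O3 | 0 < g.1.det} := by
    ext g
    rcases O3.det_eq g with h | h <;> simp [h]; norm_num
  have hclopen : IsClopen {g : O3 | g.1.det = 1} :=
    ⟨isClosed_eq hdet continuous_const, hset ▸ isOpen_lt continuous_const hdet⟩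
  exact continuous_const.if (fun g hg => by
    rw [hclopen.frontier_eq] at hg; exact hg.elim) continuous_const

/-- The homomorphism `(g, 𝒯 ^ ε) ↦ a ^ η(g) * b ^ ε` for commuting `a` and `b` with square `1`. -/
noncomputable def parityHom (a b : SO3) (ha : a * a = 1) (hb : b * b = 1) (hab : Commute a b) :
    O3 × Z2T →ₜ* SO3 where
  toFun p := a ^ (parityExp p.1).val * b ^ (Multiplicative.toAdd p.2).val
  map_one' := by simp [parityExp]
  map_mul' p q := by
    simp only [Prod.fst_mul, Prod.snd_mul, toAdd_mul, parityExp_mul, pow_val_add ha,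
      pow_val_add hb]
    exact ((hab.pow_pow _ _).symm.mul_mul_mul_comm _ _).symm
  continuous_toFun :=
    (continuous_of_discreteTopology
      (f := fun p : ZMod 2 × Z2T => a ^ p.1.val * b ^ (Multiplicative.toAdd p.2).val)).comp
      ((continuous_parityExp.comp continuous_fst).prodMk continuous_snd)

theorem parityHom_apply (a b : SO3) (ha : a * a = 1) (hb : b * b = 1) (hab : Commute a b)
    (p : O3 × Z2T) : parityHom a b ha hb hab p =
      a ^ (parityExp p.1).val * b ^ (Multiplicative.toAdd p.2).val := rfl

theorem properPart_mul (g h : O3) : properPart (g * h) = properPart g * properPart h := by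
  apply Subtype.ext
  change (g.1 * h.1).det • (g.1 * h.1) = (g.1.det • g.1) * (h.1.det • h.1)
  rw [det_mul, smul_mul_smul_comm]

/-- The homomorphism `(g, 𝒯 ^ ε) ↦ (det g) g`. -/
noncomputable def properPartHom : O3 × Z2T →ₜ* SO3 where
  toFun p := properPart p.1
  map_one' := Subtype.ext (by simp [properPart])
  map_mul' p q := properPart_mul _ _
  continuous_toFun := by
    have h : Continuous fun p : O3 × Z2T => p.1.1 := continuous_subtype_val.comp continuous_fst
    exact (h.matrix_det.smul h).subtype_mk _

theorem properPartHom_apply (p : O3 × Z2T) : properPartHom p = properPart p.1 := rfl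

/-- The inclusion of `SO(3)` into `O(3)`. -/
def SO3.toO3 : SO3 →* O3 where
  toFun g := ⟨g.1, g.2.1⟩
  map_one' := rfl
  map_mul' _ _ := rfl

theorem SO3.continuous_toO3 : Continuous SO3.toO3 :=
  continuous_subtype_val.subtype_mk _

theorem parityExp_toO3 (g : SO3) : parityExp (SO3.toO3 g) = 0 :=
  if_pos g.det_eq

theorem parityExp_one : parityExp 1 = 0 := by
  simp [parityExp]

theorem parityExp_neg_one : parityExp (-1) = 1 := by
  have h : ((-1 : O3) : Matrix (Fin 3) (Fin 3) ℝ).det = -1 := by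
    change (-1 : Matrix (Fin 3) (Fin 3) ℝ).det = -1
    rw [det_neg, det_one, Fintype.card_fin]; norm_num
  rw [parityExp, h, if_neg (by norm_num)]

theorem properPart_toO3 (g : SO3) : properPart (SO3.toO3 g) = g := by
  apply Subtype.ext
  change g.1.det • g.1 = g.1
  rw [g.det_eq, one_smul]

theorem properPart_neg_one : properPart (-1) = 1 := by
  apply Subtype.ext
  change (-1 : Matrix (Fin 3) (Fin 3) ℝ).det • (-1 : Matrix (Fin 3) (Fin 3) ℝ) = 1
  rw [det_neg, det_one, Fintype.card_fin]; norm_num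

theorem properPart_one : properPart 1 = 1 := properPart_toO3 1

/-- `O(3)` is generated by `SO(3)` and the central inversion. -/
theorem O3.eq_toO3_mul (g : O3) : g = SO3.toO3 (properPart g) * (-1) ^ (parityExp g).val := by
  apply Subtype.ext
  have hne : (-1 : ℝ) ≠ 1 := by norm_num
  rcases O3.det_eq g with h | h
  · have he : parityExp g = 0 := if_pos h
    rw [he]
    change g.1 = (g.1.det • g.1) * 1
    rw [h, one_smul, mul_one]
  · have he : parityExp g = 1 := if_neg (by rw [h]; exact hne)
    rw [he, ZMod.val_one, pow_one]
    change g.1 = (g.1.det • g.1) * (-1)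
    rw [h]; simp

/-! ### Classification up to conjugation -/

section Generators

variable (ψ : O3 × Z2T →ₜ* SO3)

/-- `O(3) × Z₂` is the product of `SO(3)` with the groups generated by the inversion and by the time
reversal. -/
theorem hom_apply_eq (p : O3 × Z2T) :
    ψ p = ψ (SO3.toO3 (properPart p.1), 1) * (ψ (-1, 1) ^ (parityExp p.1).val *
      ψ (1, Multiplicative.ofAdd 1) ^ (Multiplicative.toAdd p.2).val) := by
  rw [← map_pow, ← map_pow, ← map_mul, ← map_mul]
  congr 1
  ext1
  · simpa using O3.eq_toO3_mul p.1
  · have h : ∀ t : Z2T, t = Multiplicative.ofAdd 1 ^ (Multiplicative.toAdd t).val := by decide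
    simpa using h p.2

theorem hom_inversion_mul_self : ψ (-1, 1) * ψ (-1, 1) = 1 := by
  rw [← map_mul, Prod.mk_mul_mk, neg_mul_neg, one_mul, one_mul]
  exact map_one ψ

theorem hom_reversal_mul_self :
    ψ (1, Multiplicative.ofAdd 1) * ψ (1, Multiplicative.ofAdd 1) = 1 := by
  rw [← map_mul, Prod.mk_mul_mk, one_mul, ← ofAdd_add]
  exact map_one ψ

theorem commute_hom_inversion (q : O3 × Z2T) : Commute (ψ (-1, 1)) (ψ q) := by
  rw [Commute, SemiconjBy, ← map_mul, ← map_mul]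
  congr 1
  ext1
  · simp
  · simp

theorem commute_hom_reversal (q : O3 × Z2T) : Commute (ψ (1, Multiplicative.ofAdd 1)) (ψ q) := by
  rw [Commute, SemiconjBy, ← map_mul, ← map_mul]
  congr 1
  ext1
  · simp
  · exact mul_comm _ _

/-- A homomorphism that is trivial on `SO(3)` is determined by the images of the inversion and of
the time reversal, so conjugating these images conjugates the homomorphism. -/
theorem conjEquiv_of_trivial_on_SO3 (h1 : ∀ g : SO3, ψ (SO3.toO3 g, 1) = 1)
    (φ : O3 × Z2T →ₜ* SO3) (a b : SO3)
    (hφ : ∀ p, φ p = a ^ (parityExp p.1).val * b ^ (Multiplicative.toAdd p.2).val) (h : SO3)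
    (hψa : h * ψ (-1, 1) * h⁻¹ = a) (hψb : h * ψ (1, Multiplicative.ofAdd 1) * h⁻¹ = b) :
    ConjEquiv ψ φ := by
  refine ⟨h, fun p => ?_⟩
  rw [hom_apply_eq ψ p, h1, one_mul, hφ, ← hψa, ← hψb, conj_pow, conj_pow]
  group

/-- If `SO(3)` is mapped by an inner automorphism, the images of the inversion and of the time
reversal are central in `SO(3)`, hence trivial. -/
theorem conjEquiv_properPartHom (h : SO3)
    (hψ : ∀ g : SO3, ψ (SO3.toO3 g, 1) = h * g * h⁻¹) : ConjEquiv ψ properPartHom := by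
  -- an element that commutes with the image of `SO(3)`, which is all of `SO(3)`, is trivial
  have hc : ∀ c : SO3, (∀ q, Commute c (ψ q)) → c = 1 := fun c hc =>
    SO3.eq_one_of_forall_commute c fun g => by
      have h2 := hc (SO3.toO3 (h⁻¹ * g * h), 1)
      rw [hψ, show h * (h⁻¹ * g * h) * h⁻¹ = g by group] at h2
      exact h2
  refine ⟨h⁻¹, fun p => ?_⟩
  rw [hom_apply_eq ψ p, hψ, hc _ (commute_hom_inversion ψ), hc _ (commute_hom_reversal ψ),
    properPartHom_apply]
  simp only [one_pow, mul_one]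
  group

end Generators

theorem ConjEquiv.apply_eq_one_iff {φ ψ : O3 × Z2T →ₜ* SO3} (h : ConjEquiv φ ψ) (p : O3 × Z2T) :
    φ p = 1 ↔ ψ p = 1 := by
  obtain ⟨k, hk⟩ := h
  rw [hk, conj_eq_one_iff]

theorem halfTurn_mul_halfTurn_comm (n m : Fin 3 → ℝ) (hn : n ⬝ᵥ n = 1) (hm : m ⬝ᵥ m = 1)
    (h : n ⬝ᵥ m = 0) : Commute (SO3.halfTurn n hn) (SO3.halfTurn m hm) := by
  have h' : m ⬝ᵥ n = 0 := by rw [dotProduct_comm, h]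
  apply Subtype.ext
  rw [SO3.coe_mul, SO3.coe_mul, SO3.coe_halfTurn, SO3.coe_halfTurn]
  simp only [sub_mul, mul_sub, smul_mul_smul, vecMulVec_mul_vecMulVec, h, h', zero_smul,
    vecMulVec_zero, smul_zero, mul_one, one_mul]
  abel

theorem halfTurn_mul_halfTurn_ne_one (n m : Fin 3 → ℝ) (hn : n ⬝ᵥ n = 1) (hm : m ⬝ᵥ m = 1)
    (h : n ⬝ᵥ m = 0) : SO3.halfTurn n hn * SO3.halfTurn m hm ≠ 1 := by
  intro h1
  have h2 := SO3.trace_halfTurn_mul_halfTurn n m hn hm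
  rw [h1, h, SO3.coe_one, trace_one, Fintype.card_fin] at h2
  norm_num at h2

/-- The six representatives, for a pair of perpendicular unit vectors. -/
noncomputable def representative (z x : Fin 3 → ℝ) (hz : z ⬝ᵥ z = 1) (hx : x ⬝ᵥ x = 1)
    (hzx : z ⬝ᵥ x = 0) : Fin 6 → (O3 × Z2T →ₜ* SO3) :=
  ![parityHom 1 1 (one_mul 1) (one_mul 1) (Commute.one_left 1),
    parityHom 1 (SO3.halfTurn z hz) (one_mul 1) (SO3.halfTurn_mul_self z hz) (Commute.one_left _),
    parityHom (SO3.halfTurn z hz) 1 (SO3.halfTurn_mul_self z hz) (one_mul 1) (Commute.one_right _),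
    parityHom (SO3.halfTurn z hz) (SO3.halfTurn z hz) (SO3.halfTurn_mul_self z hz)
      (SO3.halfTurn_mul_self z hz) (Commute.refl _),
    parityHom (SO3.halfTurn z hz) (SO3.halfTurn x hx) (SO3.halfTurn_mul_self z hz)
      (SO3.halfTurn_mul_self x hx) (halfTurn_mul_halfTurn_comm z x hz hx hzx),
    properPartHom]

section Representatives

variable (z x : Fin 3 → ℝ) (hz : z ⬝ᵥ z = 1) (hx : x ⬝ᵥ x = 1) (hzx : z ⬝ᵥ x = 0)

/-- Conjugate homomorphisms have the same kernel, and the kernels of the representatives are told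
apart by the inversion, the time reversal, their product, and a half-turn. -/
theorem representative_injective (i j : Fin 6)
    (h : ConjEquiv (representative z x hz hx hzx i) (representative z x hz hx hzx j)) : i = j := by
  have hz1 := SO3.halfTurn_ne_one z hz
  have hx1 := SO3.halfTurn_ne_one x hx
  have hzx1 := halfTurn_mul_halfTurn_ne_one z x hz hx hzx
  have hzz := SO3.halfTurn_mul_self z hz
  have hP : ∀ i, representative z x hz hx hzx i (-1, 1) = 1 ↔
      ![true, true, false, false, false, true] i = true := by
    intro i
    fin_cases i <;> simp [representative, parityHom_apply, properPartHom_apply, parityExp_neg_one,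
      properPart_neg_one, ZMod.val_one, hz1]
  have hT : ∀ i, representative z x hz hx hzx i (1, Multiplicative.ofAdd 1) = 1 ↔
      ![true, false, true, false, false, true] i = true := by
    intro i
    fin_cases i <;> simp [representative, parityHom_apply, properPartHom_apply, parityExp_one,
      properPart_one, ZMod.val_one, hz1, hx1]
  have hPT : ∀ i, representative z x hz hx hzx i (-1, Multiplicative.ofAdd 1) = 1 ↔
      ![true, false, false, true, false, true] i = true := by
    intro i
    fin_cases i <;> simp [representative, parityHom_apply, properPartHom_apply, parityExp_neg_one,
      properPart_neg_one, ZMod.val_one, hz1, hzz, hzx1]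
  have hR : ∀ i, representative z x hz hx hzx i (SO3.toO3 (SO3.halfTurn z hz), 1) = 1 ↔
      ![true, true, true, true, true, false] i = true := by
    intro i
    fin_cases i <;> simp [representative, parityHom_apply, properPartHom_apply, parityExp_toO3,
      properPart_toO3, hz1]
  have e1 := (hP i).symm.trans ((h.apply_eq_one_iff _).trans (hP j))
  have e2 := (hT i).symm.trans ((h.apply_eq_one_iff _).trans (hT j))
  have e3 := (hPT i).symm.trans ((h.apply_eq_one_iff _).trans (hPT j))
  have e4 := (hR i).symm.trans ((h.apply_eq_one_iff _).trans (hR j))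
  clear hP hT hPT hR h
  revert i j
  decide

/-- Every continuous homomorphism is conjugate to a representative. If it is trivial on `SO(3)`, it
is determined by the images of the inversion and of the time reversal; these commute and are trivial
or half-turns, about axes that are equal or perpendicular. -/
theorem exists_conjEquiv_representative (ψ : O3 × Z2T →ₜ* SO3) :
    ∃ i, ConjEquiv ψ (representative z x hz hx hzx i) := by
  have hcont : Continuous fun g : SO3 => ψ (SO3.toO3 g, 1) :=
    (map_continuous ψ).comp (SO3.continuous_toO3.prodMk continuous_const)
  rcases SO3.hom_trivial_or_inner
    ((ψ : O3 × Z2T →* SO3).comp ((MonoidHom.inl O3 Z2T).comp SO3.toO3)) hcont with h1 | ⟨h, hh⟩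
  swap
  · exact ⟨5, conjEquiv_properPartHom ψ h hh⟩
  change ∀ g : SO3, ψ (SO3.toO3 g, 1) = 1 at h1
  have ha := hom_inversion_mul_self ψ
  have hb := hom_reversal_mul_self ψ
  have hab := commute_hom_inversion ψ (1, Multiplicative.ofAdd 1)
  by_cases ha1 : ψ (-1, 1) = 1
  · by_cases hb1 : ψ (1, Multiplicative.ofAdd 1) = 1
    · exact ⟨0, conjEquiv_of_trivial_on_SO3 ψ h1 _ 1 1 (fun _ => rfl) 1
        (by simp [ha1]) (by simp [hb1])⟩
    · obtain ⟨m, hm, e⟩ := SO3.exists_eq_halfTurn _ hb hb1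
      obtain ⟨k, hk⟩ := SO3.exists_mulVec_eq m z hm hz
      exact ⟨1, conjEquiv_of_trivial_on_SO3 ψ h1 _ _ _ (fun _ => rfl) k (by simp [ha1])
        (by rw [e, SO3.conj_halfTurn k m z hm hz hk])⟩
  · obtain ⟨n, hn, e⟩ := SO3.exists_eq_halfTurn _ ha ha1
    by_cases hb1 : ψ (1, Multiplicative.ofAdd 1) = 1
    · obtain ⟨k, hk⟩ := SO3.exists_mulVec_eq n z hn hz
      exact ⟨2, conjEquiv_of_trivial_on_SO3 ψ h1 _ _ _ (fun _ => rfl) k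
        (by rw [e, SO3.conj_halfTurn k n z hn hz hk]) (by simp [hb1])⟩
    · by_cases heq : ψ (-1, 1) = ψ (1, Multiplicative.ofAdd 1)
      · obtain ⟨k, hk⟩ := SO3.exists_mulVec_eq n z hn hz
        exact ⟨3, conjEquiv_of_trivial_on_SO3 ψ h1 _ _ _ (fun _ => rfl) k
          (by rw [e, SO3.conj_halfTurn k n z hn hz hk])
          (by rw [← heq, e, SO3.conj_halfTurn k n z hn hz hk])⟩
      · obtain ⟨m, hm, e'⟩ := SO3.exists_eq_halfTurn _ hb hb1
        rw [e, e'] at hab heq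
        have hnm := SO3.dotProduct_eq_zero_of_commute n m hn hm hab heq
        obtain ⟨k, hkn, hkm⟩ := SO3.exists_mulVec_eq_pair n m z x hn hm hnm hz hx hzx
        exact ⟨4, conjEquiv_of_trivial_on_SO3 ψ h1 _ _ _ (fun _ => rfl) k
          (by rw [e, SO3.conj_halfTurn k n z hn hz hkn])
          (by rw [e', SO3.conj_halfTurn k m x hm hx hkm])⟩

end Representatives

end

theorem mainTheorem2 (z x : Fin 3 → ℝ) (hz : z ⬝ᵥ z = 1) (hx : x ⬝ᵥ x = 1) (hzx : z ⬝ᵥ x = 0) :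
    ∃ φ₁ φ₂ φ₃ φ₄ φ₅ φ₆ : O3 × Z2T →ₜ* SO3,
      (∀ (g : O3) (ε : ZMod 2), φ₁ (g, Multiplicative.ofAdd ε) = 1) ∧
      (∀ (g : O3) (ε : ZMod 2), φ₂ (g, Multiplicative.ofAdd ε) =
        axisRotation z hz Real.pi ^ ε.val) ∧
      (∀ (g : O3) (ε : ZMod 2), φ₃ (g, Multiplicative.ofAdd ε) =
        axisRotation z hz Real.pi ^ (parityExp g).val) ∧
      (∀ (g : O3) (ε : ZMod 2), φ₄ (g, Multiplicative.ofAdd ε) =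
        axisRotation z hz Real.pi ^ (parityExp g + ε).val) ∧
      (∀ (g : O3) (ε : ZMod 2), φ₅ (g, Multiplicative.ofAdd ε) =
        axisRotation z hz Real.pi ^ (parityExp g).val * axisRotation x hx Real.pi ^ ε.val) ∧
      (∀ (g : O3) (ε : ZMod 2), φ₆ (g, Multiplicative.ofAdd ε) = properPart g) ∧
      -- the six homomorphisms are pairwise inequivalent
      (∀ i j : Fin 6, i ≠ j →
        ¬ ConjEquiv (![φ₁, φ₂, φ₃, φ₄, φ₅, φ₆] i) (![φ₁, φ₂, φ₃, φ₄, φ₅, φ₆] j)) ∧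
      -- every continuous homomorphism is equivalent to one of them
      (∀ ψ : O3 × Z2T →ₜ* SO3, ∃ i : Fin 6,
        ConjEquiv ψ (![φ₁, φ₂, φ₃, φ₄, φ₅, φ₆] i)) ∧
      -- there are exactly six equivalence classes
      Nat.card (Quotient conjSetoid) = 6 := by
  have hrep : ∀ i, ![representative z x hz hx hzx 0, representative z x hz hx hzx 1,
      representative z x hz hx hzx 2, representative z x hz hx hzx 3,
      representative z x hz hx hzx 4, representative z x hz hx hzx 5] i =
      representative z x hz hx hzx i := by
    intro i; fin_cases i <;> rfl
  refine ⟨representative z x hz hx hzx 0, representative z x hz hx hzx 1,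
    representative z x hz hx hzx 2, representative z x hz hx hzx 3,
    representative z x hz hx hzx 4, representative z x hz hx hzx 5,
    fun g ε => ?_, fun g ε => ?_, fun g ε => ?_, fun g ε => ?_, fun g ε => rfl, fun g ε => rfl,
    fun i j hij h => ?_, fun ψ => ?_, ?_⟩
  · change (1 : SO3) ^ _ * 1 ^ _ = 1
    rw [one_pow, one_pow, one_mul]
  · change (1 : SO3) ^ _ * _ = _
    rw [one_pow, one_mul]
    rfl
  · change _ * (1 : SO3) ^ _ = _
    rw [one_pow, mul_one]
    rfl
  · exact (pow_val_add (SO3.halfTurn_mul_self z hz) _ _).symm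
  · rw [hrep, hrep] at h
    exact hij (representative_injective z x hz hx hzx i j h)
  · simp only [hrep]
    exact exists_conjEquiv_representative z x hz hx hzx ψ
  · rw [← Nat.card_eq_of_bijective
      (fun i : Fin 6 => Quotient.mk conjSetoid (representative z x hz hx hzx i)) ⟨?_, ?_⟩,
      Nat.card_fin]
    · intro i j hij
      exact representative_injective z x hz hx hzx i j (Quotient.exact hij)
    · intro q
      induction q using Quotient.inductionOn with
      | h ψ =>
        obtain ⟨i, hi⟩ := exists_conjEquiv_representative z x hz hx hzx ψ
        exact ⟨i, (Quotient.sound hi).symm⟩
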